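/- Let $\mathbf{t} = t_0t_1t_2\cdots = 01101001\cdots$ be the Thue--Morse word, where $t_m \in \{0,1\}$ is the parity of the number of ones in the binary expansion of $m$. For $n \geq 0$ let $c(n)$ be the number of length-$n$ factors (blocks $t_i t_{i+1}\cdots t_{i+n-1}$, $i \geq 0$) of $\mathbf{t}$, where factors that are cyclic rotations of one another are counted only once. Then, for every integer $n \geq 0$, $$c(n) = \tfrac{4}{3}n - 4 \quad\text{if and only if}\quad n \in J,$$ where $J = \{ (2^{2i+1}+1)\,2^j : i \geq 1,\ j \geq 0 \}$. -/

import Mathlib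

/-- The Thue-Morse word `0110100110010110...` over the alphabet `{0, 1}`, with positions counted
from `0`: its letter at position `n` is the parity of the number of ones in the binary
expansion of `n`. -/
def thueMorse (n : ℕ) : ZMod 2 := ((Nat.digits 2 n).sum : ZMod 2)

/-- The factor `x[i] x[i+1] ... x[i+n-1]` of length `n` of the infinite word `x`. -/
def factorAt {α : Type*} (x : ℕ → α) (i n : ℕ) : List α :=
  (List.range n).map (fun k => x (i + k))

/-- The set of all factors of length `n` of the infinite word `x`. -/
def factors {α : Type*} (x : ℕ → α) (n : ℕ) : Set (List α) :=
  {w | ∃ i : ℕ, w = factorAt x i n}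

/-- The cyclic complexity `c_x(n)` of the infinite word `x` over a finite alphabet: the number of
factors of length `n` of `x`, where factors that are cyclic rotations of one another are counted
once. (`Cycle α` is the type of lists over `α` up to rotation.) -/
noncomputable def cyclicComplexity {α : Type*} (x : ℕ → α) (n : ℕ) : ℕ :=
  ((fun w : List α => (w : Cycle α)) '' factors x n).ncard

/-- The set counted by `cyclicComplexity` is finite when the alphabet is finite. -/
theorem finite_cyclic_factors {α : Type*} [Finite α] (x : ℕ → α) (n : ℕ) :
    ((fun w : List α => (w : Cycle α)) '' factors x n).Finite := by
  refine Set.Finite.image _ ((List.finite_length_eq α n).subset ?_)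
  rintro w ⟨i, rfl⟩
  simp [factorAt]

/-- The set `J` of all numbers `(2^(2i+1) + 1) 2^j` with `i ≥ 1` and `j ≥ 0`. -/
def setJ : Set ℕ :=
  {n | ∃ i j : ℕ, 1 ≤ i ∧ n = (2 ^ (2 * i + 1) + 1) * 2 ^ j}

/-!
Let `μ` be the Thue-Morse morphism `b ↦ b (b + 1)`, let `p` be the factor complexity of the
Thue-Morse word, let `E m` be the number of its factors of length `m + 1` with distinct end
letters, and let `F m` be the number of pairs of factors `(a + 1) x` and `x a` with `x` of length
`m` such that `(a + 1) x a` is not a factor. Up to rotation, the factors of even length `2 * m` are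
the words `μ(x)` with `x` a factor, and the words `μ(x) a a` with `(a + 1) x a` a factor. The
factors of odd length are the words `μ(x) a` with `x a` or `(a + 1) x` a factor, where
`(a + 1) x` and `x a` in the place of `x` give the same cyclic word. Counting both families yields
`c (2 * m) = c m + E m` and `c (2 * m + 1) = E (2 * m + 1) - (p (m + 2) - p (m + 1)) - F m` for
`4 ≤ m`.

The numbers `E m` are at least `4 / 3 * m`, by the recursions that desubstitution gives for them;
the differences of `p` are `2` or `4`; and `F m` vanishes unless `m = 3 * 2 ^ k` with `k` odd,
where it is at most `4` while `E (2 * m + 1)` is large. So `3 * c n + 12 - 4 * n` is nonnegative.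
At `n = 2 * m + 1` it vanishes exactly when `m` is a power of `4`, and at the products of such `n`
with powers of `2` the lower bound for `E` is attained, so that doubling preserves the zeros.
-/

theorem ncard_image_eq_of_forall_eq_iff {α β γ : Type*} {f : α → β} {g : α → γ} {s : Set α}
    (h : ∀ a ∈ s, ∀ b ∈ s, f a = f b ↔ g a = g b) : (f '' s).ncard = (g '' s).ncard := by
  refine Set.ncard_congr (fun _ hw => g hw.choose)
    (fun _ hw => Set.mem_image_of_mem g hw.choose_spec.1) (fun v w hv hw hvw => ?_) ?_
  · rw [← hv.choose_spec.2, ← hw.choose_spec.2]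
    exact (h _ hv.choose_spec.1 _ hw.choose_spec.1).mpr hvw
  · rintro _ ⟨a, ha, rfl⟩
    have hfa := Set.mem_image_of_mem f ha
    exact ⟨f a, hfa, (h _ hfa.choose_spec.1 _ ha).mp hfa.choose_spec.2⟩

section Words

variable {α : Type*}

theorem length_factorAt (x : ℕ → α) (i n : ℕ) : (factorAt x i n).length = n := by
  simp [factorAt]

theorem factorAt_eq_factorAt_iff {x : ℕ → α} {i j n : ℕ} :
    factorAt x i n = factorAt x j n ↔ ∀ k < n, x (i + k) = x (j + k) := by
  simp [factorAt]

theorem factorAt_succ (x : ℕ → α) (i n : ℕ) :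
    factorAt x i (n + 1) = x i :: factorAt x (i + 1) n := by
  simp [factorAt, List.range_succ_eq_map, Function.comp_def, add_assoc, add_comm 1]

theorem factorAt_add (x : ℕ → α) (i m n : ℕ) :
    factorAt x i (m + n) = factorAt x i m ++ factorAt x (i + m) n := by
  simp [factorAt, List.range_add, Function.comp_def, add_assoc]

theorem factorAt_succ_right (x : ℕ → α) (i n : ℕ) :
    factorAt x i (n + 1) = factorAt x i n ++ [x (i + n)] :=
  factorAt_add x i n 1

theorem factorAt_mem_factors (x : ℕ → α) (i n : ℕ) : factorAt x i n ∈ factors x n := ⟨i, rfl⟩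

theorem length_of_mem_factors {x : ℕ → α} {n : ℕ} {w : List α} (h : w ∈ factors x n) :
    w.length = n := by
  obtain ⟨i, rfl⟩ := h
  exact length_factorAt x i n

theorem finite_factors [Finite α] (x : ℕ → α) (n : ℕ) : (factors x n).Finite :=
  (List.finite_length_eq α n).subset fun _ => length_of_mem_factors

theorem cons_mem_factors_iff {x : ℕ → α} {n : ℕ} {a : α} {w : List α} :
    a :: w ∈ factors x (n + 1) ↔ ∃ i, x i = a ∧ factorAt x (i + 1) n = w := by
  simp only [factors, Set.mem_ofPred_eq, factorAt_succ, List.cons.injEq, eq_comm]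

theorem append_singleton_mem_factors_iff {x : ℕ → α} {n : ℕ} {a : α} {w : List α} :
    w ++ [a] ∈ factors x (n + 1) ↔ ∃ i, factorAt x i n = w ∧ x (i + n) = a := by
  simp only [factors, Set.mem_ofPred_eq, factorAt_succ_right, List.append_singleton_inj, eq_comm]

theorem cons_append_singleton_mem_factors_iff {x : ℕ → α} {n : ℕ} {a b : α} {w : List α} :
    a :: (w ++ [b]) ∈ factors x (n + 2) ↔
      ∃ i, x i = a ∧ factorAt x (i + 1) n = w ∧ x (i + 1 + n) = b := by
  simp only [cons_mem_factors_iff, factorAt_succ_right, List.append_singleton_inj]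

theorem mem_factors_of_isInfix {x : ℕ → α} {n : ℕ} {v w : List α} (hvw : v <:+: w)
    (hw : w ∈ factors x n) : v ∈ factors x v.length := by
  obtain ⟨u, u', rfl⟩ := hvw
  obtain ⟨i, hi⟩ := hw
  have hn : n = u.length + v.length + u'.length := by
    simpa [length_factorAt, add_assoc] using (congrArg List.length hi).symm
  rw [hn, factorAt_add, factorAt_add] at hi
  obtain ⟨hi, -⟩ := List.append_inj hi (by simp [length_factorAt])
  exact ⟨_, (List.append_inj hi (by simp [length_factorAt])).2⟩

/-- The factors of length `n` of the infinite word `x` that have an occurrence starting at a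
position of the set `s`. Restricting the positions by a condition on the letters near them, or by
their parity, selects the kinds of factors that are counted below. -/
def factorsOn (x : ℕ → α) (s : Set ℕ) (n : ℕ) : Set (List α) :=
  (fun i => factorAt x i n) '' s

theorem factorsOn_univ (x : ℕ → α) (n : ℕ) : factorsOn x Set.univ n = factors x n := by
  ext w
  simp only [factorsOn, factors, Set.image_univ, Set.mem_range, Set.mem_ofPred_eq, eq_comm]

theorem ncard_factorsOn_union [Finite α] {x : ℕ → α} {s t : Set ℕ} {n : ℕ}
    (h : ∀ i ∈ s, ∀ j ∈ t, factorAt x i n ≠ factorAt x j n) :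
    (factorsOn x (s ∪ t) n).ncard = (factorsOn x s n).ncard + (factorsOn x t n).ncard := by
  have finite_factorsOn (s : Set ℕ) : (factorsOn x s n).Finite :=
    (finite_factors x n).subset (Set.image_subset_iff.mpr fun i _ => factorAt_mem_factors x i n)
  rw [← Set.ncard_union_eq _ (finite_factorsOn s) (finite_factorsOn t), factorsOn, Set.image_union]
  · rfl
  · rw [Set.disjoint_left]
    rintro _ ⟨i, hi, rfl⟩ ⟨j, hj, hij⟩
    exact h i hi j hj hij.symm

end Words

section ThueMorse

theorem thueMorse_two_mul (i : ℕ) : thueMorse (2 * i) = thueMorse i := by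
  obtain rfl | hi := Nat.eq_zero_or_pos i
  · rfl
  · rw [thueMorse, thueMorse, Nat.digits_def' (by norm_num) (by omega)]
    simp

theorem thueMorse_two_mul_add_one (i : ℕ) : thueMorse (2 * i + 1) = thueMorse i + 1 := by
  rw [thueMorse, thueMorse, Nat.digits_def' (by norm_num) (by omega),
    show (2 * i + 1) / 2 = i by omega, show (2 * i + 1) % 2 = 1 by omega]
  simp [add_comm]

theorem thueMorse_two_mul_add (i k : ℕ) :
    thueMorse (2 * i + k) = thueMorse (i + k / 2) + k := by
  obtain ⟨l, rfl | rfl⟩ := Nat.even_or_odd' k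
  · rw [← mul_add, thueMorse_two_mul, Nat.mul_div_cancel_left l two_pos]
    simp [CharTwo.two_eq_zero]
  · rw [← add_assoc, ← mul_add, thueMorse_two_mul_add_one, Nat.mul_add_div two_pos]
    simp [CharTwo.two_eq_zero]

theorem thueMorse_succ_of_even {i : ℕ} (hi : Even i) : thueMorse (i + 1) = thueMorse i + 1 := by
  obtain ⟨k, rfl⟩ := even_iff_exists_two_mul.mp hi
  rw [thueMorse_two_mul_add_one, thueMorse_two_mul]

theorem thueMorse_ne_succ_of_even {i : ℕ} (hi : Even i) : thueMorse i ≠ thueMorse (i + 1) := by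
  simp [thueMorse_succ_of_even hi]

theorem thueMorse_not_cube (i : ℕ) :
    ¬ (thueMorse i = thueMorse (i + 1) ∧ thueMorse (i + 1) = thueMorse (i + 2)) := by
  rintro ⟨h₁, h₂⟩
  obtain hi | hi := Nat.even_or_odd i
  · exact thueMorse_ne_succ_of_even hi h₁
  · exact thueMorse_ne_succ_of_even hi.add_one h₂

theorem even_iff_thueMorse_ne {i : ℕ} : Even i ↔
    thueMorse i ≠ thueMorse (i + 1) ∧ thueMorse (i + 2) ≠ thueMorse (i + 3) := by
  refine ⟨fun hi => ⟨thueMorse_ne_succ_of_even hi,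
    thueMorse_ne_succ_of_even (hi.add even_two)⟩, fun ⟨h₁, h₂⟩ => ?_⟩
  by_contra hi
  obtain ⟨k, rfl⟩ := Nat.not_even_iff_odd.mp hi
  have h₀ := thueMorse_two_mul_add k
  rw [add_assoc, h₀, h₀] at h₁
  rw [add_assoc, add_assoc, h₀, h₀] at h₂
  norm_num at h₁ h₂
  apply thueMorse_not_cube k
  generalize thueMorse k = a, thueMorse (k + 1) = b, thueMorse (k + 2) = c at h₁ h₂ ⊢
  decide +revert

theorem even_iff_even_of_factorAt_eq {i j n : ℕ} (hn : 4 ≤ n)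
    (h : factorAt thueMorse i n = factorAt thueMorse j n) : Even i ↔ Even j := by
  have hk (k : ℕ) (hk : k < 4) := factorAt_eq_factorAt_iff.mp h k (by omega)
  rw [even_iff_thueMorse_ne, even_iff_thueMorse_ne, ← hk 1 (by norm_num), ← hk 2 (by norm_num),
    ← hk 3 (by norm_num)]
  simp only [show thueMorse i = thueMorse j from hk 0 (by norm_num)]

theorem factorAt_two_mul_add_eq_iff {i j n p : ℕ} (hn : 0 < n) (hp : p ≤ 1) :
    factorAt thueMorse (2 * i + p) n = factorAt thueMorse (2 * j + p) n ↔
      factorAt thueMorse i ((n + p + 1) / 2) = factorAt thueMorse j ((n + p + 1) / 2) := by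
  simp only [factorAt_eq_factorAt_iff, add_assoc, thueMorse_two_mul_add, add_left_inj]
  refine ⟨fun h k hk => ?_, fun h k hk => h _ (by omega)⟩
  have hkp := h (2 * k - p) (by omega)
  rwa [show (p + (2 * k - p)) / 2 = k by omega] at hkp

theorem factorAt_succ_eq_of_odd_add {i j n : ℕ} (hn : 4 ≤ n) (hi : Odd (i + n))
    (h : factorAt thueMorse i n = factorAt thueMorse j n) :
    factorAt thueMorse i (n + 1) = factorAt thueMorse j (n + 1) := by
  obtain ⟨m, rfl⟩ := Nat.exists_eq_add_of_le' (show 1 ≤ n by omega)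
  have hij := even_iff_even_of_factorAt_eq hn h
  have him : Even (i + m) := by simpa [← add_assoc, Nat.odd_add_one] using hi
  have hjm : Even (j + m) := by rwa [Nat.even_add, ← hij, ← Nat.even_add]
  rw [factorAt_succ_right, factorAt_succ_right _ j, ← add_assoc, ← add_assoc,
    thueMorse_succ_of_even him, thueMorse_succ_of_even hjm, h,
    factorAt_eq_factorAt_iff.mp h m (by omega)]

theorem factorAt_succ_eq_of_even {i j n : ℕ} (hn : 4 ≤ n) (hi : Even i)
    (h : factorAt thueMorse (i + 1) n = factorAt thueMorse (j + 1) n) :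
    factorAt thueMorse i (n + 1) = factorAt thueMorse j (n + 1) := by
  have hij := even_iff_even_of_factorAt_eq hn h
  have hj : Even j := by simpa [Nat.even_add_one, hi] using hij
  have h₀ : thueMorse (i + 1) = thueMorse (j + 1) :=
    factorAt_eq_factorAt_iff.mp h 0 (by omega)
  rw [thueMorse_succ_of_even hi, thueMorse_succ_of_even hj, add_left_inj] at h₀
  rw [factorAt_succ, factorAt_succ, h, h₀]

theorem le_two_of_replicate_isInfix {n k : ℕ} {w : List (ZMod 2)} {a : ZMod 2}
    (hw : w ∈ factors thueMorse n) (ha : List.replicate k a <:+: w) : k ≤ 2 := by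
  by_contra! hk
  obtain ⟨i, hi⟩ := mem_factors_of_isInfix ha hw
  rw [List.length_replicate, eq_comm, List.eq_replicate_iff] at hi
  have hletter (l : ℕ) (hl : l < k) : thueMorse (i + l) = a :=
    hi.2 _ (List.mem_map_of_mem (List.mem_range.mpr hl))
  have h₀ := hletter 0 (by omega)
  have h₁ := hletter 1 (by omega)
  have h₂ := hletter 2 hk
  exact thueMorse_not_cube i ⟨h₀.trans h₁.symm, h₁.trans h₂.symm⟩

end ThueMorse

section ShortFactors

theorem exists_lt_factorAt_five_eq (i : ℕ) :
    ∃ j < 24, factorAt thueMorse i 5 = factorAt thueMorse j 5 := by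
  have lift_two_mul (n N : ℕ) (i : ℕ)
      (h : ∃ j < N, factorAt thueMorse (i / 2) (n + 1) = factorAt thueMorse j (n + 1)) :
      ∃ j < 2 * N, factorAt thueMorse i (2 * n + 1) = factorAt thueMorse j (2 * n + 1) := by
    obtain ⟨j, hj, h⟩ := h
    refine ⟨2 * j + i % 2, by omega, ?_⟩
    conv_lhs => rw [← Nat.div_add_mod i 2]
    rwa [factorAt_two_mul_add_eq_iff (by omega) (by omega),
      show (2 * n + 1 + i % 2 + 1) / 2 = n + 1 by omega]
  have length_two (i : ℕ) : ∃ j < 6, factorAt thueMorse i 2 = factorAt thueMorse j 2 := by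
    rw [factorAt_succ, factorAt_succ, show factorAt thueMorse (i + 1 + 1) 0 = [] from rfl]
    generalize thueMorse i = a, thueMorse (i + 1) = b
    decide +revert
  exact lift_two_mul 2 12 i (lift_two_mul 1 6 (i / 2) (length_two _))

theorem exists_lt_factorAt_eq {n : ℕ} (hn : n ≤ 5) (i : ℕ) :
    ∃ j < 24, factorAt thueMorse i n = factorAt thueMorse j n := by
  obtain ⟨j, hj, h⟩ := exists_lt_factorAt_five_eq i
  rw [factorAt_eq_factorAt_iff] at h
  exact ⟨j, hj, factorAt_eq_factorAt_iff.mpr fun k hk => h k (by omega)⟩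

theorem mem_factors_thueMorse_iff {n : ℕ} (hn : n ≤ 5) {w : List (ZMod 2)} :
    w ∈ factors thueMorse n ↔ ∃ j < 24, w = factorAt thueMorse j n := by
  refine ⟨?_, fun ⟨j, _, h⟩ => ⟨j, h⟩⟩
  rintro ⟨i, rfl⟩
  exact exists_lt_factorAt_eq hn i

theorem ncard_factorsOn_eq_card {n : ℕ} (hn : n ≤ 5) {p : ℕ → Prop} [DecidablePred p]
    (hp : ∀ i j, factorAt thueMorse i n = factorAt thueMorse j n → p i → p j) :
    (factorsOn thueMorse {i | p i} n).ncard =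
      (((Finset.range 24).filter p).image fun i => factorAt thueMorse i n).card := by
  rw [← Set.ncard_coe_finset]
  congr 1
  ext w
  simp only [factorsOn, Set.mem_image, Set.mem_ofPred_eq, Finset.coe_image, Finset.coe_filter,
    Finset.mem_range]
  constructor
  · rintro ⟨i, hi, rfl⟩
    obtain ⟨j, hj, hij⟩ := exists_lt_factorAt_eq hn i
    exact ⟨j, ⟨hj, hp i j hij hi⟩, hij.symm⟩
  · rintro ⟨j, ⟨_, hj⟩, rfl⟩
    exact ⟨j, hj, rfl⟩

theorem ncard_factors_eq_card {n : ℕ} (hn : n ≤ 5) : (factors thueMorse n).ncard =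
    ((Finset.range 24).image fun i => factorAt thueMorse i n).card := by
  rw [← factorsOn_univ, ← Finset.filter_true (Finset.range 24)]
  exact ncard_factorsOn_eq_card hn fun _ _ _ _ => trivial

end ShortFactors

theorem ncard_factorsOn_thueMorse {n : ℕ} (hn : 4 ≤ n) (s : Set ℕ) :
    (factorsOn thueMorse s n).ncard =
      (factorsOn thueMorse {i | 2 * i ∈ s} ((n + 1) / 2)).ncard +
      (factorsOn thueMorse {i | 2 * i + 1 ∈ s} ((n + 2) / 2)).ncard := by
  have hs : s = (fun i => 2 * i + 0) '' {i | 2 * i ∈ s} ∪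
      (fun i => 2 * i + 1) '' {i | 2 * i + 1 ∈ s} := by
    refine Set.Subset.antisymm (fun i hi => ?_) ?_
    · obtain ⟨k, rfl | rfl⟩ := Nat.even_or_odd' i
      exacts [.inl ⟨k, hi, rfl⟩, .inr ⟨k, hi, rfl⟩]
    · rintro _ (⟨k, hk, rfl⟩ | ⟨k, hk, rfl⟩) <;> exact hk
  conv_lhs => rw [hs]
  rw [ncard_factorsOn_union]
  · simp only [factorsOn, Set.image_image]
    congr 1 <;> exact ncard_image_eq_of_forall_eq_iff fun i _ j _ =>
      factorAt_two_mul_add_eq_iff (by omega) (by norm_num)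
  · rintro _ ⟨i, _, rfl⟩ _ ⟨j, _, rfl⟩ hij
    simpa [Nat.even_add_one] using even_iff_even_of_factorAt_eq hn hij

theorem ncard_factors_two_mul {n : ℕ} (hn : 2 ≤ n) : (factors thueMorse (2 * n)).ncard =
    (factors thueMorse n).ncard + (factors thueMorse (n + 1)).ncard := by
  simp only [← factorsOn_univ]
  rw [ncard_factorsOn_thueMorse (by omega), show (2 * n + 1) / 2 = n by omega,
    show (2 * n + 2) / 2 = n + 1 by omega]
  rfl

theorem ncard_factors_two_mul_add_one {n : ℕ} (hn : 2 ≤ n) :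
    (factors thueMorse (2 * n + 1)).ncard = 2 * (factors thueMorse (n + 1)).ncard := by
  simp only [← factorsOn_univ]
  rw [ncard_factorsOn_thueMorse (by omega), show (2 * n + 1 + 1) / 2 = n + 1 by omega,
    show (2 * n + 1 + 2) / 2 = n + 1 by omega, two_mul]
  rfl

/-- The number of factors of length `m + 1` of the Thue-Morse word whose first and last letters
add up to `δ`: the end letters agree when `δ = 0` and differ when `δ = 1`. -/
noncomputable def endsCount (m : ℕ) (δ : ZMod 2) : ℕ :=
  (factorsOn thueMorse {i | thueMorse i + thueMorse (i + m) = δ} (m + 1)).ncard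

theorem ncard_factors_succ (m : ℕ) :
    (factors thueMorse (m + 1)).ncard = endsCount m 0 + endsCount m 1 := by
  have huniv : (Set.univ : Set ℕ) = {i | thueMorse i + thueMorse (i + m) = 0} ∪
      {i | thueMorse i + thueMorse (i + m) = 1} := by
    ext i
    have (a : ZMod 2) : a = 0 ∨ a = 1 := by decide +revert
    simpa using this _
  rw [← factorsOn_univ, huniv]
  refine ncard_factorsOn_union fun i hi j hj h => zero_ne_one (α := ZMod 2) ?_
  rw [factorAt_eq_factorAt_iff] at h
  have h₀ := h 0 (by omega)
  rw [add_zero, add_zero] at h₀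
  rw [Set.mem_ofPred_eq] at hi hj
  rw [← hi, ← hj, h₀, h m (by omega)]

theorem endsCount_two_mul {m : ℕ} (hm : 2 ≤ m) (δ : ZMod 2) :
    endsCount (2 * m) δ = 2 * endsCount m δ := by
  have h₀ (i : ℕ) : thueMorse (2 * i) + thueMorse (2 * i + 2 * m) =
      thueMorse i + thueMorse (i + m) := by
    rw [← mul_add, thueMorse_two_mul, thueMorse_two_mul]
  have h₁ (i : ℕ) : thueMorse (2 * i + 1) + thueMorse (2 * i + 1 + 2 * m) =
      thueMorse i + thueMorse (i + m) := by
    rw [add_right_comm, ← mul_add, thueMorse_two_mul_add_one, thueMorse_two_mul_add_one,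
      add_add_add_comm, CharTwo.add_self_eq_zero, add_zero]
  rw [endsCount, ncard_factorsOn_thueMorse (by omega), show (2 * m + 1 + 1) / 2 = m + 1 by omega,
    show (2 * m + 1 + 2) / 2 = m + 1 by omega]
  simp only [Set.mem_ofPred_eq, h₀, h₁, ← two_mul, endsCount]

theorem endsCount_two_mul_add_one {m : ℕ} (hm : 1 ≤ m) (δ : ZMod 2) :
    endsCount (2 * m + 1) δ = endsCount m (δ + 1) + endsCount (m + 1) (δ + 1) := by
  have h₀ (i : ℕ) : thueMorse (2 * i) + thueMorse (2 * i + (2 * m + 1)) = δ ↔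
      thueMorse i + thueMorse (i + m) = δ + 1 := by
    rw [← add_assoc, ← mul_add, thueMorse_two_mul, thueMorse_two_mul_add_one, ← add_assoc,
      CharTwo.add_eq_iff_eq_add]
  have h₁ (i : ℕ) : thueMorse (2 * i + 1) + thueMorse (2 * i + 1 + (2 * m + 1)) = δ ↔
      thueMorse i + thueMorse (i + (m + 1)) = δ + 1 := by
    rw [show 2 * i + 1 + (2 * m + 1) = 2 * (i + (m + 1)) by ring, thueMorse_two_mul_add_one,
      thueMorse_two_mul, add_right_comm, CharTwo.add_eq_iff_eq_add]
  rw [endsCount, ncard_factorsOn_thueMorse (by omega),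
    show (2 * m + 1 + 1 + 1) / 2 = m + 1 by omega,
    show (2 * m + 1 + 1 + 2) / 2 = m + 1 + 1 by omega]
  simp only [Set.mem_ofPred_eq, h₀, h₁, endsCount]

theorem endsCount_eq_card {m : ℕ} (hm : m ≤ 4) (δ : ZMod 2) :
    endsCount m δ = (((Finset.range 24).filter fun i => thueMorse i + thueMorse (i + m) = δ).image
      fun i => factorAt thueMorse i (m + 1)).card := by
  refine ncard_factorsOn_eq_card (by omega) fun i j hij hi => ?_
  rw [factorAt_eq_factorAt_iff] at hij
  rw [← hij m (by omega), ← hi, ← add_zero i, hij 0 (by omega), add_zero, add_zero]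

@[elab_as_elim]
theorem two_le_binary_induction {P : ∀ n : ℕ, 2 ≤ n → Prop} (two : P 2 le_rfl)
    (three : P 3 (by norm_num))
    (even : ∀ m (hm : 2 ≤ m), P m hm → P (m + 1) (by omega) → P (2 * m) (by omega))
    (odd : ∀ m (hm : 2 ≤ m), P m hm → P (m + 1) (by omega) → P (2 * m + 1) (by omega))
    (n : ℕ) (hn : 2 ≤ n) : P n hn := by
  induction n using Nat.strong_induction_on with
  | _ n ih =>
  obtain ⟨m, hm⟩ := Nat.even_or_odd' n
  obtain h | h : m = 1 ∨ 2 ≤ m := by omega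
  · subst h
    obtain rfl | rfl := hm
    exacts [two, three]
  · have ih₀ := ih m (by omega) h
    have ih₁ := ih (m + 1) (by omega) (by omega)
    obtain rfl | rfl := hm
    exacts [even m h ih₀ ih₁, odd m h ih₀ ih₁]

section Excess

/-- Three times the amount by which `endsCount m δ` exceeds `4 * m / 3`, the value around which it
fluctuates. -/
noncomputable def endsExcess (m : ℕ) (δ : ZMod 2) : ℤ := 3 * endsCount m δ - 4 * m

theorem endsExcess_two_mul {m : ℕ} (hm : 2 ≤ m) (δ : ZMod 2) :
    endsExcess (2 * m) δ = 2 * endsExcess m δ := by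
  rw [endsExcess, endsExcess, endsCount_two_mul hm]
  push_cast
  ring

theorem endsExcess_two_mul_add_one {m : ℕ} (hm : 1 ≤ m) (δ : ZMod 2) :
    endsExcess (2 * m + 1) δ = endsExcess m (δ + 1) + endsExcess (m + 1) (δ + 1) := by
  rw [endsExcess, endsExcess, endsExcess, endsCount_two_mul_add_one hm]
  push_cast
  ring

theorem endsExcess_one (δ : ZMod 2) : endsExcess 1 δ = 2 := by
  have h : endsCount 1 δ = 2 := by
    rw [endsCount_eq_card (by norm_num)]
    decide +revert
  simp [endsExcess, h]

theorem endsExcess_two_one : endsExcess 2 1 = 4 := by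
  have h : endsCount 2 1 = 4 := by
    rw [endsCount_eq_card (by norm_num)]
    decide
  simp [endsExcess, h]

theorem endsExcess_two_zero : endsExcess 2 0 = -2 := by
  have h : endsCount 2 0 = 2 := by
    rw [endsCount_eq_card (by norm_num)]
    decide
  simp [endsExcess, h]

theorem endsExcess_two_mul_add_one_one {m : ℕ} (hm : 1 ≤ m) :
    endsExcess (2 * m + 1) 1 = endsExcess m 0 + endsExcess (m + 1) 0 :=
  endsExcess_two_mul_add_one hm 1

theorem endsExcess_two_mul_add_one_zero {m : ℕ} (hm : 1 ≤ m) :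
    endsExcess (2 * m + 1) 0 = endsExcess m 1 + endsExcess (m + 1) 1 :=
  endsExcess_two_mul_add_one hm 0

theorem endsExcess_three_one : endsExcess 3 1 = 0 := by
  simp [endsExcess_two_mul_add_one_one le_rfl, endsExcess_one, endsExcess_two_zero]

theorem endsExcess_three_zero : endsExcess 3 0 = 6 := by
  simp [endsExcess_two_mul_add_one_zero le_rfl, endsExcess_one, endsExcess_two_one]

theorem endsExcess_bounds {m : ℕ} (hm : 2 ≤ m) :
    0 ≤ endsExcess m 1 ∧ 0 < endsExcess m 1 + endsExcess m 0 ∧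
      0 ≤ endsExcess m 1 + 2 * endsExcess m 0 ∧ 0 ≤ endsExcess m 0 + endsExcess (m + 1) 0 := by
  induction m, hm using two_le_binary_induction with
  | two => norm_num [endsExcess_two_one, endsExcess_two_zero, endsExcess_three_zero]
  | three =>
    norm_num [endsExcess_three_one, endsExcess_three_zero, endsExcess_two_zero,
      endsExcess_two_mul (le_refl 2)]
  | even m hm ih ih' =>
    rw [endsExcess_two_mul hm, endsExcess_two_mul hm, endsExcess_two_mul_add_one_zero (by omega)]
    omega
  | odd m hm ih ih' =>
    rw [endsExcess_two_mul_add_one_one (by omega), endsExcess_two_mul_add_one_zero (by omega),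
      show 2 * m + 1 + 1 = 2 * (m + 1) by ring, endsExcess_two_mul (by omega)]
    omega

theorem endsExcess_one_nonneg {m : ℕ} (hm : 2 ≤ m) : 0 ≤ endsExcess m 1 :=
  (endsExcess_bounds hm).1

theorem eq_two_pow_of_endsExcess_eq_zero {m : ℕ} (hm : 2 ≤ m)
    (h : endsExcess m 1 + 2 * endsExcess m 0 = 0) : ∃ k, 1 ≤ k ∧ m = 2 ^ k := by
  induction m, hm using two_le_binary_induction with
  | two => exact ⟨1, le_rfl, rfl⟩
  | three => norm_num [endsExcess_three_one, endsExcess_three_zero] at h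
  | even m hm ih _ =>
    rw [endsExcess_two_mul hm, endsExcess_two_mul hm] at h
    obtain ⟨k, hk, rfl⟩ := ih (by omega)
    exact ⟨k + 1, by omega, by rw [pow_succ']⟩
  | odd m hm _ _ =>
    rw [endsExcess_two_mul_add_one_one (by omega),
      endsExcess_two_mul_add_one_zero (by omega)] at h
    have := endsExcess_bounds hm
    have := endsExcess_bounds (show 2 ≤ m + 1 by omega)
    omega

theorem endsExcess_two_pow {k : ℕ} (hk : 1 ≤ k) :
    endsExcess (2 ^ k) 1 = 2 * 2 ^ k ∧ endsExcess (2 ^ k) 0 = - 2 ^ k := by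
  induction k, hk using Nat.le_induction with
  | base => norm_num [endsExcess_two_one, endsExcess_two_zero]
  | succ k hk ih =>
    have h2 : 2 ≤ 2 ^ k := le_self_pow₀ (by norm_num) (by omega)
    rw [pow_succ', endsExcess_two_mul h2, endsExcess_two_mul h2, ih.1, ih.2]
    constructor <;> ring

theorem endsExcess_two_pow_add_two_add_one {k : ℕ} (hk : 1 ≤ k) :
    endsExcess (2 ^ (k + 2) + 1) 1 = endsExcess (2 ^ k + 1) 1 := by
  have h1 : 1 ≤ 2 ^ k := Nat.one_le_two_pow
  rw [show 2 ^ (k + 2) + 1 = 2 * (2 * 2 ^ k) + 1 by ring,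
    endsExcess_two_mul_add_one_one (by omega), endsExcess_two_mul_add_one_zero h1, ← pow_succ',
    (endsExcess_two_pow (by omega)).2, (endsExcess_two_pow hk).1]
  ring

theorem endsExcess_two_pow_odd_add_one (j : ℕ) : endsExcess (2 ^ (2 * j + 1) + 1) 1 = 0 := by
  induction j with
  | zero => exact endsExcess_three_one
  | succ j ih => exact (endsExcess_two_pow_add_two_add_one (k := 2 * j + 1) (by omega)).trans ih

theorem endsExcess_two_pow_even_add_one {j : ℕ} (hj : 1 ≤ j) :
    endsExcess (2 ^ (2 * j) + 1) 1 = 4 := by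
  induction j, hj using Nat.le_induction with
  | base =>
    exact (endsExcess_two_mul_add_one_one one_le_two).trans
      (by norm_num [endsExcess_two_zero, endsExcess_three_zero])
  | succ j hj ih => exact (endsExcess_two_pow_add_two_add_one (k := 2 * j) (by omega)).trans ih

theorem endsExcess_three_mul_two_pow (k : ℕ) : endsExcess (3 * 2 ^ k) 0 = 6 * 2 ^ k := by
  induction k with
  | zero => exact endsExcess_three_zero
  | succ k ih =>
    have h1 : 1 ≤ 2 ^ k := Nat.one_le_two_pow
    rw [show 3 * 2 ^ (k + 1) = 2 * (3 * 2 ^ k) by ring, endsExcess_two_mul (by omega), ih]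
    ring

theorem le_endsExcess_six_mul_two_pow_add_one {k : ℕ} (hk : 1 ≤ k) :
    6 * 2 ^ k ≤ endsExcess (2 * (3 * 2 ^ k) + 1) 1 := by
  obtain ⟨l, rfl⟩ := Nat.exists_eq_add_of_le' hk
  have h1 : 1 ≤ 2 ^ l := Nat.one_le_two_pow
  have h₀ := endsExcess_one_nonneg (show 2 ≤ 3 * 2 ^ l by omega)
  have h₁ := endsExcess_one_nonneg (show 2 ≤ 3 * 2 ^ l + 1 by omega)
  rw [endsExcess_two_mul_add_one_one (by rw [pow_succ']; omega), endsExcess_three_mul_two_pow,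
    show 3 * 2 ^ (l + 1) + 1 = 2 * (3 * 2 ^ l) + 1 by ring,
    endsExcess_two_mul_add_one_zero (by omega)]
  omega

end Excess

section FactorComplexity

/-- The first difference of the factor complexity of the Thue-Morse word: the number of factors of
length `n + 1` minus the number of factors of length `n`. -/
noncomputable def complexityDifference (n : ℕ) : ℤ :=
  (factors thueMorse (n + 1)).ncard - (factors thueMorse n).ncard

theorem complexityDifference_two_mul {n : ℕ} (hn : 2 ≤ n) :
    complexityDifference (2 * n) = complexityDifference n := by
  rw [complexityDifference, complexityDifference, ncard_factors_two_mul hn,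
    ncard_factors_two_mul_add_one hn]
  push_cast
  ring

theorem complexityDifference_two_mul_add_one {n : ℕ} (hn : 2 ≤ n) :
    complexityDifference (2 * n + 1) = complexityDifference (n + 1) := by
  rw [complexityDifference, complexityDifference, show 2 * n + 1 + 1 = 2 * (n + 1) by ring,
    ncard_factors_two_mul (by omega), ncard_factors_two_mul_add_one hn]
  push_cast
  ring

theorem complexityDifference_two : complexityDifference 2 = 2 := by
  rw [complexityDifference, ncard_factors_eq_card (by norm_num),
    ncard_factors_eq_card (by norm_num)]
  decide

theorem complexityDifference_three : complexityDifference 3 = 4 := by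
  rw [complexityDifference, ncard_factors_eq_card (by norm_num),
    ncard_factors_eq_card (by norm_num)]
  decide

theorem complexityDifference_eq_two_or_four {n : ℕ} (hn : 2 ≤ n) :
    complexityDifference n = 2 ∨ complexityDifference n = 4 := by
  induction n, hn using two_le_binary_induction with
  | two => exact .inl complexityDifference_two
  | three => exact .inr complexityDifference_three
  | even m hm ih _ => rwa [complexityDifference_two_mul hm]
  | odd m hm _ ih => rwa [complexityDifference_two_mul_add_one hm]

theorem complexityDifference_two_pow {k : ℕ} (hk : 1 ≤ k) : complexityDifference (2 ^ k) = 2 := by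
  induction k, hk using Nat.le_induction with
  | base => exact complexityDifference_two
  | succ k hk ih =>
    rw [pow_succ', complexityDifference_two_mul (le_self_pow₀ (by norm_num) (by omega)), ih]

theorem complexityDifference_two_pow_add_one {k : ℕ} (hk : 1 ≤ k) :
    complexityDifference (2 ^ k + 1) = 4 := by
  induction k, hk using Nat.le_induction with
  | base => exact complexityDifference_three
  | succ k hk ih =>
    rw [pow_succ', complexityDifference_two_mul_add_one (le_self_pow₀ (by norm_num) (by omega)), ih]

theorem complexityDifference_three_mul_two_pow_add_one (k : ℕ) :
    complexityDifference (3 * 2 ^ k + 1) = 2 := by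
  induction k with
  | zero => exact (complexityDifference_two_mul le_rfl).trans complexityDifference_two
  | succ k ih =>
    have h1 : 1 ≤ 2 ^ k := Nat.one_le_two_pow
    rw [show 3 * 2 ^ (k + 1) = 2 * (3 * 2 ^ k) by ring,
      complexityDifference_two_mul_add_one (by omega), ih]

end FactorComplexity

theorem endsExcess_eq_zero_and_complexityDifference_eq_four_iff {m : ℕ} (hm : 4 ≤ m) :
    (endsExcess (2 * m + 1) 1 = 0 ∧ complexityDifference (m + 1) = 4) ↔
      ∃ j, 1 ≤ j ∧ m = 2 ^ (2 * j) := by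
  constructor
  · rintro ⟨hE, hp⟩
    rw [endsExcess_two_mul_add_one_one (by omega)] at hE
    obtain ⟨k, hk⟩ := Nat.even_or_odd' m
    have h₀ := endsExcess_bounds (show 2 ≤ k by omega)
    have h₁ := endsExcess_bounds (show 2 ≤ k + 1 by omega)
    obtain rfl | rfl := hk
    · rw [endsExcess_two_mul (by omega), endsExcess_two_mul_add_one_zero (by omega)] at hE
      obtain ⟨l, hl, rfl⟩ := eq_two_pow_of_endsExcess_eq_zero (m := k) (by omega) (by omega)
      obtain ⟨j, rfl | rfl⟩ := Nat.even_or_odd' l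
      · have := endsExcess_two_pow_even_add_one (show 1 ≤ j by omega)
        omega
      · exact ⟨j + 1, by omega, by ring⟩
    · rw [endsExcess_two_mul_add_one_zero (by omega), show 2 * k + 1 + 1 = 2 * (k + 1) by ring,
        endsExcess_two_mul (by omega)] at hE
      obtain ⟨l, hl, hkl⟩ :=
        eq_two_pow_of_endsExcess_eq_zero (show 2 ≤ k + 1 by omega) (by omega)
      rw [show 2 * k + 1 + 1 = 2 ^ (l + 1) by rw [pow_succ', ← hkl]; ring,
        complexityDifference_two_pow (by omega)] at hp
      norm_num at hp
  · rintro ⟨j, hj, rfl⟩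
    rw [← pow_succ', endsExcess_two_pow_odd_add_one,
      complexityDifference_two_pow_add_one (by omega)]
    exact ⟨rfl, rfl⟩

theorem isRotated_iff_exists_append {α : Type*} {l l' : List α} :
    l ~r l' ↔ ∃ u v, l = u ++ v ∧ l' = v ++ u := by
  constructor
  · rintro ⟨n, rfl⟩
    exact ⟨_, _, (List.take_append_drop (n % l.length) l).symm, List.rotate_eq_drop_append_take_mod⟩
  · rintro ⟨u, v, rfl, rfl⟩
    exact List.isRotated_append

section Morphism

/-- The Thue-Morse morphism `μ : 0 ↦ 01, 1 ↦ 10`, whose fixed point is the Thue-Morse word. -/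
def thueMorseMap : List (ZMod 2) → List (ZMod 2)
  | [] => []
  | a :: l => a :: (a + 1) :: thueMorseMap l

theorem thueMorseMap_append (u v : List (ZMod 2)) :
    thueMorseMap (u ++ v) = thueMorseMap u ++ thueMorseMap v := by
  induction u with
  | nil => rfl
  | cons a u ih => simp [thueMorseMap, ih]

theorem thueMorseMap_concat (u : List (ZMod 2)) (a : ZMod 2) :
    thueMorseMap (u ++ [a]) = thueMorseMap u ++ [a, a + 1] :=
  thueMorseMap_append u [a]

theorem length_thueMorseMap (u : List (ZMod 2)) : (thueMorseMap u).length = 2 * u.length := by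
  induction u with
  | nil => rfl
  | cons a u ih => simp only [thueMorseMap, List.length_cons, ih, mul_add_one]

theorem sum_thueMorseMap (u : List (ZMod 2)) : (thueMorseMap u).sum = u.length := by
  induction u with
  | nil => rfl
  | cons a u ih =>
    rw [thueMorseMap, List.sum_cons, List.sum_cons, ih, ← add_assoc, ← add_assoc,
      CharTwo.add_self_eq_zero, zero_add, List.length_cons, Nat.cast_succ, add_comm]

theorem thueMorseMap_injective : Function.Injective thueMorseMap := by
  intro u
  induction u with
  | nil =>
    rintro (_ | _) h
    · rfl
    · cases h
  | cons a u ih =>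
    rintro (_ | ⟨b, v⟩) h
    · cases h
    · simp only [thueMorseMap, List.cons.injEq] at h
      rw [h.1, ih h.2.2]

theorem exists_of_thueMorseMap_append_eq_append_of_even {y s u v : List (ZMod 2)}
    (h : thueMorseMap y ++ s = u ++ v) (hu : Even u.length) (hy : u.length ≤ 2 * y.length) :
    ∃ y₁ y₂, y = y₁ ++ y₂ ∧ u = thueMorseMap y₁ ∧ v = thueMorseMap y₂ ++ s := by
  obtain ⟨k, hk⟩ := hu
  rw [← List.take_append_drop k y, thueMorseMap_append, List.append_assoc] at h
  obtain ⟨h₁, h₂⟩ := List.append_inj h (by rw [length_thueMorseMap, List.length_take]; omega)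
  exact ⟨_, _, (List.take_append_drop k y).symm, h₁.symm, h₂.symm⟩

theorem exists_of_thueMorseMap_append_eq_append_of_odd {y s u v : List (ZMod 2)}
    (h : thueMorseMap y ++ s = u ++ v) (hu : Odd u.length) (hy : u.length ≤ 2 * y.length) :
    ∃ y₁ b y₂, y = y₁ ++ b :: y₂ ∧ u = thueMorseMap y₁ ++ [b] ∧
      v = (b + 1) :: (thueMorseMap y₂ ++ s) := by
  obtain rfl | ⟨u, b, rfl⟩ := List.eq_nil_or_concat' u
  · simp at hu
  rw [List.length_append, List.length_singleton] at hu hy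
  rw [List.append_assoc] at h
  obtain ⟨y₁, y₂, rfl, rfl, h₂⟩ := exists_of_thueMorseMap_append_eq_append_of_even h
    (by simpa [Nat.odd_add_one] using hu) (by omega)
  obtain _ | ⟨c, y₂⟩ := y₂
  · simp [length_thueMorseMap] at hy
  · simp only [thueMorseMap, List.cons_append, List.nil_append, List.cons.injEq] at h₂
    obtain ⟨rfl, rfl⟩ := h₂
    exact ⟨y₁, b, y₂, rfl, rfl, rfl⟩

theorem eq_replicate_of_cons_thueMorseMap_eq_append {a b : ZMod 2} {v w : List (ZMod 2)}
    (h : a :: thueMorseMap v = thueMorseMap w ++ [b]) :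
    ∃ k, v = List.replicate k (a + 1) ∧ w = List.replicate k a ∧ b = a := by
  induction v generalizing a w with
  | nil =>
    obtain _ | ⟨c, w⟩ := w
    · exact ⟨0, rfl, rfl, (List.head_eq_of_cons_eq h).symm⟩
    · simp [thueMorseMap] at h
  | cons d v ih =>
    obtain _ | ⟨c, w⟩ := w
    · simp [thueMorseMap] at h
    · simp only [thueMorseMap, List.cons_append, List.cons.injEq] at h
      obtain ⟨rfl, rfl, h⟩ := h
      rw [CharTwo.add_cancel_right] at h
      obtain ⟨k, hv, hw, hb⟩ := ih h
      exact ⟨k + 1, by rw [hv, List.replicate_succ], by rw [hw, List.replicate_succ], hb⟩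

theorem eq_replicate_of_cons_thueMorseMap_append_eq {a b : ZMod 2} {v w : List (ZMod 2)}
    (h : a :: (thueMorseMap v ++ [b]) = thueMorseMap w) :
    ∃ k, v = List.replicate k (a + 1) ∧ b = a + 1 := by
  obtain rfl | ⟨w, c, rfl⟩ := List.eq_nil_or_concat' w
  · cases h
  · rw [thueMorseMap_concat, ← List.cons_append, List.append_cons (thueMorseMap w),
      List.append_singleton_inj] at h
    obtain ⟨h, rfl⟩ := h
    obtain ⟨k, hv, -, rfl⟩ := eq_replicate_of_cons_thueMorseMap_eq_append h
    exact ⟨k, hv, rfl⟩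

theorem factorAt_two_mul_even (i n : ℕ) :
    factorAt thueMorse (2 * i) (2 * n) = thueMorseMap (factorAt thueMorse i n) := by
  induction n with
  | zero => rfl
  | succ n ih =>
    rw [mul_add_one, factorAt_add, ih, factorAt_succ_right _ i, thueMorseMap_concat, ← mul_add,
      factorAt_succ, factorAt_succ, thueMorse_two_mul, thueMorse_two_mul_add_one]
    rfl

theorem factorAt_two_mul_odd (i n : ℕ) : factorAt thueMorse (2 * i) (2 * n + 1) =
    thueMorseMap (factorAt thueMorse i n) ++ [thueMorse (i + n)] := by
  rw [factorAt_succ_right, factorAt_two_mul_even, ← mul_add, thueMorse_two_mul]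

theorem factorAt_two_mul_add_one_odd (i n : ℕ) : factorAt thueMorse (2 * i + 1) (2 * n + 1) =
    (thueMorse i + 1) :: thueMorseMap (factorAt thueMorse (i + 1) n) := by
  rw [factorAt_succ, thueMorse_two_mul_add_one, ← factorAt_two_mul_even]
  rfl

theorem factorAt_two_mul_add_one_even (i n : ℕ) : factorAt thueMorse (2 * i + 1) (2 * n + 2) =
    (thueMorse i + 1) ::
      (thueMorseMap (factorAt thueMorse (i + 1) n) ++ [thueMorse (i + 1 + n)]) := by
  rw [factorAt_succ, thueMorse_two_mul_add_one, ← factorAt_two_mul_odd]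
  rfl

end Morphism

section EvenLength

theorem thueMorseMap_isRotated {x y : List (ZMod 2)} (h : x ~r y) :
    thueMorseMap x ~r thueMorseMap y := by
  obtain ⟨u, v, rfl, rfl⟩ := isRotated_iff_exists_append.mp h
  rw [thueMorseMap_append, thueMorseMap_append]
  exact List.isRotated_append

theorem isRotated_or_eq_replicate_of_thueMorseMap_isRotated {x y : List (ZMod 2)}
    (h : thueMorseMap x ~r thueMorseMap y) : x ~r y ∨ ∃ k b, x = List.replicate k b := by
  obtain ⟨u, v, hx, hy⟩ := isRotated_iff_exists_append.mp h
  have hu : u.length ≤ 2 * x.length := by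
    rw [← length_thueMorseMap, hx, List.length_append]
    omega
  rw [← List.append_nil (thueMorseMap x)] at hx
  obtain he | ho := Nat.even_or_odd u.length
  · obtain ⟨x₁, x₂, rfl, rfl, rfl⟩ := exists_of_thueMorseMap_append_eq_append_of_even hx he hu
    rw [List.append_nil, ← thueMorseMap_append] at hy
    rw [thueMorseMap_injective hy]
    exact .inl List.isRotated_append
  · obtain ⟨x₁, b, x₂, rfl, rfl, rfl⟩ :=
      exists_of_thueMorseMap_append_eq_append_of_odd hx ho hu
    rw [List.append_nil, List.cons_append, ← List.append_assoc, ← thueMorseMap_append] at hy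
    obtain ⟨k, hk, -⟩ := eq_replicate_of_cons_thueMorseMap_append_eq hy.symm
    rw [CharTwo.add_cancel_right] at hk
    have hperm : (x₁ ++ b :: x₂).Perm (List.replicate (k + 1) b) := by
      rw [List.replicate_succ, ← hk]
      exact (List.isRotated_append (l := x₁) (l' := b :: x₂)).perm
    exact .inr ⟨k + 1, b, List.perm_replicate.mp hperm⟩

theorem not_thueMorseMap_isRotated_append_square {x y : List (ZMod 2)} {a : ZMod 2} :
    ¬ thueMorseMap x ~r thueMorseMap y ++ [a, a] := by
  intro h
  have hlength : x.length = y.length + 1 := by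
    have := h.perm.length_eq
    simp only [List.length_append, length_thueMorseMap, List.length_cons, List.length_nil] at this
    omega
  have hsum := h.perm.sum_eq
  simp [sum_thueMorseMap, hlength, CharTwo.add_self_eq_zero] at hsum

theorem eq_and_eq_of_append_square_of_even {y y' u v : List (ZMod 2)} {a a' : ZMod 2}
    (h : thueMorseMap y ++ [a, a] = u ++ v) (h' : thueMorseMap y' ++ [a', a'] = v ++ u)
    (hu : Even u.length) : y = y' ∧ a = a' := by
  have eq_and_eq (h : thueMorseMap y ++ [a, a] = thueMorseMap y' ++ [a', a']) :
      y = y' ∧ a = a' := by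
    obtain ⟨h₁, h₂⟩ := List.append_inj' h rfl
    exact ⟨thueMorseMap_injective h₁, List.head_eq_of_cons_eq h₂⟩
  have hlength := congrArg List.length h
  simp only [List.length_append, length_thueMorseMap, List.length_cons, List.length_nil] at hlength
  obtain hy | hy : u.length ≤ 2 * y.length ∨ v.length = 0 := by
    obtain ⟨k, hk⟩ := hu
    omega
  · obtain ⟨y₁, y₂, rfl, rfl, rfl⟩ := exists_of_thueMorseMap_append_eq_append_of_even h hu hy
    obtain rfl | ⟨y₁, d, rfl⟩ := List.eq_nil_or_concat' y₁
    · exact eq_and_eq (by simpa [thueMorseMap] using h'.symm)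
    · rw [thueMorseMap_concat, ← List.append_assoc] at h'
      obtain ⟨-, h'⟩ := List.append_inj' h' rfl
      simp only [List.cons.injEq] at h'
      exact absurd (h'.1.symm.trans h'.2.1) (by simp)
  · rw [List.eq_nil_of_length_eq_zero hy] at h h'
    exact eq_and_eq (by simpa [h] using h'.symm)

theorem eq_replicate_append_replicate_of_append_square_of_odd {y y' u v : List (ZMod 2)}
    {a a' : ZMod 2} (h : thueMorseMap y ++ [a, a] = u ++ v)
    (h' : thueMorseMap y' ++ [a', a'] = v ++ u) (hu : Odd u.length) :
    ∃ k l, (a + 1) :: (y ++ [a]) = List.replicate k (a + 1) ++ List.replicate l a := by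
  have hlength := congrArg List.length h
  have hlength' := congrArg List.length h'
  simp only [List.length_append, length_thueMorseMap, List.length_cons, List.length_nil]
    at hlength hlength'
  rw [List.append_cons] at h'
  obtain hy | hv : u.length ≤ 2 * y.length ∨ v.length = 1 := by
    obtain ⟨k, hk⟩ := hu
    omega
  · obtain ⟨y₁, b, y₂, rfl, rfl, rfl⟩ := exists_of_thueMorseMap_append_eq_append_of_odd h hu hy
    rw [← List.append_assoc, List.append_singleton_inj] at h'
    obtain ⟨h', rfl⟩ := h'
    rw [List.append_cons (thueMorseMap y₂), ← List.cons_append, List.append_assoc] at h'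
    obtain ⟨w₁, w₂, -, h₂, h₁⟩ := exists_of_thueMorseMap_append_eq_append_of_even h'
      (by simp [length_thueMorseMap, Nat.even_add_one])
      (by simp only [List.length_append, List.length_cons, List.length_nil, length_thueMorseMap]
            at hlength hlength' ⊢
          omega)
    obtain ⟨k, rfl, -, -⟩ := eq_replicate_of_cons_thueMorseMap_eq_append h₁
    obtain ⟨l, rfl, rfl⟩ := eq_replicate_of_cons_thueMorseMap_append_eq h₂
    refine ⟨k + 1, l + 2, ?_⟩
    simp [CharTwo.add_cancel_right, List.replicate_succ, ← List.replicate_succ']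
  · obtain ⟨c, rfl⟩ := List.length_eq_one_iff.mp hv
    rw [List.append_cons, List.append_singleton_inj] at h
    obtain ⟨rfl, rfl⟩ := h
    rw [← List.append_assoc, List.append_singleton_inj] at h'
    obtain ⟨k, rfl, -⟩ := eq_replicate_of_cons_thueMorseMap_eq_append h'.1.symm
    exact ⟨k + 1, 1, by simp [List.replicate_succ]⟩

end EvenLength

section EvenComplexity

/-- The pairs `(x, a)`, with `x` of length `m`, such that `(a + 1) x a` is a factor of the
Thue-Morse word; they encode the factors of length `m + 2` whose end letters are distinct. -/
def distinctEnds (m : ℕ) : Set (List (ZMod 2) × ZMod 2) :=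
  {p | (p.2 + 1) :: (p.1 ++ [p.2]) ∈ factors thueMorse (m + 2)}

theorem ncard_distinctEnds (m : ℕ) : (distinctEnds m).ncard = endsCount (m + 1) 1 := by
  have hinj : Set.InjOn (fun p : List (ZMod 2) × ZMod 2 => (p.2 + 1) :: (p.1 ++ [p.2]))
      (distinctEnds m) := by
    rintro ⟨x, a⟩ - ⟨y, b⟩ - h
    obtain ⟨rfl, rfl⟩ := List.append_singleton_inj.mp (List.tail_eq_of_cons_eq h)
    rfl
  rw [endsCount, factorsOn, ← hinj.ncard_image]
  congr 1
  ext w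
  constructor
  · rintro ⟨⟨x, a⟩, h, rfl⟩
    obtain ⟨i, hi, rfl, ha⟩ := cons_append_singleton_mem_factors_iff.mp h
    dsimp only at hi ha ⊢
    refine ⟨i, ?_, ?_⟩
    · rw [Set.mem_ofPred_eq, hi, add_comm m, ← add_assoc, ha, add_right_comm,
        CharTwo.add_self_eq_zero, zero_add]
    · dsimp only
      rw [factorAt_succ, factorAt_succ_right, hi, ha]
  · rintro ⟨i, hi, rfl⟩
    have hi : thueMorse i = thueMorse (i + 1 + m) + 1 := by
      rwa [Set.mem_ofPred_eq, CharTwo.add_eq_iff_eq_add, add_comm 1, add_comm m, ← add_assoc] at hi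
    have hw : factorAt thueMorse i (m + 1 + 1) = (thueMorse (i + 1 + m) + 1) ::
        (factorAt thueMorse (i + 1) m ++ [thueMorse (i + 1 + m)]) := by
      rw [factorAt_succ, factorAt_succ_right, hi]
    refine ⟨(factorAt thueMorse (i + 1) m, thueMorse (i + 1 + m)), ?_, hw.symm⟩
    exact cons_append_singleton_mem_factors_iff.mpr ⟨i, hi, rfl, rfl⟩

/-- The cyclic word `μ(x) a a` of a pair `(x, a)`. -/
def squareCycle (p : List (ZMod 2) × ZMod 2) : Cycle (ZMod 2) :=
  (thueMorseMap p.1 ++ [p.2, p.2] : List (ZMod 2))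

theorem coe_factorAt_two_mul_add_one_even (i m : ℕ) :
    (factorAt thueMorse (2 * i + 1) (2 * m + 2) : Cycle (ZMod 2)) =
      (thueMorseMap (factorAt thueMorse (i + 1) m) ++ [thueMorse (i + 1 + m), thueMorse i + 1] :
        List (ZMod 2)) := by
  rw [factorAt_two_mul_add_one_even, Cycle.coe_eq_coe, ← List.singleton_append,
    List.append_cons _ _ [thueMorse i + 1]]
  exact List.isRotated_append

theorem image_coe_factors_two_mul_add_two (m : ℕ) :
    (fun w : List (ZMod 2) => (w : Cycle (ZMod 2))) '' factors thueMorse (2 * m + 2) =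
      (fun w => (thueMorseMap w : Cycle (ZMod 2))) '' factors thueMorse (m + 1) ∪
        squareCycle '' distinctEnds m := by
  apply Set.Subset.antisymm
  · rintro _ ⟨_, ⟨i, rfl⟩, rfl⟩
    dsimp only
    obtain ⟨i, rfl | rfl⟩ := Nat.even_or_odd' i
    · exact .inl ⟨_, ⟨i, rfl⟩, by rw [← mul_add_one, factorAt_two_mul_even]⟩
    rw [coe_factorAt_two_mul_add_one_even]
    by_cases h : thueMorse i = thueMorse (i + 1 + m)
    · refine .inl ⟨_, ⟨i + 1, rfl⟩, ?_⟩
      dsimp only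
      rw [factorAt_succ_right, thueMorseMap_concat, h]
    · have h : thueMorse i = thueMorse (i + 1 + m) + 1 := by
        generalize thueMorse i = a, thueMorse (i + 1 + m) = b at h ⊢
        decide +revert
      refine .inr ⟨(factorAt thueMorse (i + 1) m, thueMorse (i + 1 + m)), ?_, ?_⟩
      · exact cons_append_singleton_mem_factors_iff.mpr ⟨i, h, rfl, rfl⟩
      · rw [squareCycle, h, CharTwo.add_cancel_right]
  · rintro _ (⟨_, ⟨i, rfl⟩, rfl⟩ | ⟨⟨x, a⟩, hp, rfl⟩)
    · refine ⟨_, ⟨2 * i, rfl⟩, ?_⟩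
      dsimp only
      rw [← mul_add_one, factorAt_two_mul_even]
    · obtain ⟨i, hi, rfl, rfl⟩ := cons_append_singleton_mem_factors_iff.mp hp
      refine ⟨_, ⟨2 * i + 1, rfl⟩, ?_⟩
      dsimp only at hi ⊢
      rw [coe_factorAt_two_mul_add_one_even, squareCycle, hi, CharTwo.add_cancel_right]

theorem injOn_squareCycle {m : ℕ} (hm : 3 ≤ m) : Set.InjOn squareCycle (distinctEnds m) := by
  rintro ⟨y, a⟩ hy ⟨y', a'⟩ - h
  obtain ⟨u, v, h₁, h₂⟩ := isRotated_iff_exists_append.mp (Cycle.coe_eq_coe.mp h)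
  obtain hu | hu := Nat.even_or_odd u.length
  · exact Prod.ext_iff.mpr (eq_and_eq_of_append_square_of_even h₁ h₂ hu)
  · exfalso
    obtain ⟨k, l, hkl⟩ := eq_replicate_append_replicate_of_append_square_of_odd h₁ h₂ hu
    have hlength := length_of_mem_factors hy
    rw [hkl, List.length_append, List.length_replicate, List.length_replicate] at hlength
    have hk : k ≤ 2 := le_two_of_replicate_isInfix hy ⟨[], _, hkl.symm⟩
    have hl : l ≤ 2 := le_two_of_replicate_isInfix hy ⟨_, [], by rw [hkl, List.append_nil]⟩
    omega

theorem ncard_image_coe_thueMorseMap {m : ℕ} (hm : 3 ≤ m) :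
    ((fun w => (thueMorseMap w : Cycle (ZMod 2))) '' factors thueMorse m).ncard =
      cyclicComplexity thueMorse m := by
  refine ncard_image_eq_of_forall_eq_iff fun x hx y _ => ?_
  rw [Cycle.coe_eq_coe, Cycle.coe_eq_coe]
  refine ⟨fun h => ?_, thueMorseMap_isRotated⟩
  obtain h | ⟨k, b, rfl⟩ := isRotated_or_eq_replicate_of_thueMorseMap_isRotated h
  · exact h
  · have hlength := length_of_mem_factors hx
    have hk := le_two_of_replicate_isInfix hx List.infix_rfl
    rw [List.length_replicate] at hlength
    omega

theorem cyclicComplexity_two_mul {m : ℕ} (hm : 4 ≤ m) :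
    cyclicComplexity thueMorse (2 * m) = cyclicComplexity thueMorse m + endsCount m 1 := by
  obtain ⟨m, rfl⟩ := Nat.exists_eq_add_of_le' (show 1 ≤ m by omega)
  have hdisjoint : Disjoint
      ((fun w => (thueMorseMap w : Cycle (ZMod 2))) '' factors thueMorse (m + 1))
      (squareCycle '' distinctEnds m) := by
    rw [Set.disjoint_left]
    rintro _ ⟨x, -, rfl⟩ ⟨p, -, h⟩
    exact not_thueMorseMap_isRotated_append_square (Cycle.coe_eq_coe.mp h.symm)
  have hfinite := finite_cyclic_factors thueMorse (2 * m + 2)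
  rw [image_coe_factors_two_mul_add_two, Set.finite_union] at hfinite
  rw [mul_add_one, cyclicComplexity, image_coe_factors_two_mul_add_two,
    Set.ncard_union_eq hdisjoint hfinite.1 hfinite.2, ncard_image_coe_thueMorseMap (by omega),
    (injOn_squareCycle (by omega)).ncard_image, ncard_distinctEnds]

end EvenComplexity

section ForbiddenExtensions

/-- The pairs `(x, a)`, with `x` of length `m`, such that `(a + δ) x` and `x a` are factors of the
Thue-Morse word although `(a + δ) x a` is not. -/
def forbiddenExtensions (δ : ZMod 2) (m : ℕ) : Set (List (ZMod 2) × ZMod 2) :=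
  {p | (p.2 + δ) :: p.1 ∈ factors thueMorse (m + 1) ∧ p.1 ++ [p.2] ∈ factors thueMorse (m + 1) ∧
    (p.2 + δ) :: (p.1 ++ [p.2]) ∉ factors thueMorse (m + 2)}

theorem finite_forbiddenExtensions (δ : ZMod 2) (m : ℕ) : (forbiddenExtensions δ m).Finite := by
  refine Set.Finite.of_finite_image (f := fun p => p.1 ++ [p.2])
    ((finite_factors thueMorse (m + 1)).subset ?_) ?_
  · rintro _ ⟨p, hp, rfl⟩
    exact hp.2.1
  · rintro p - q - h
    exact Prod.ext_iff.mpr (List.append_singleton_inj.mp h)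

theorem exists_odd_of_mem_forbiddenExtensions {δ a : ZMod 2} {m : ℕ} {x : List (ZMod 2)}
    (hm : 4 ≤ m) (h : (x, a) ∈ forbiddenExtensions δ m) :
    ∃ i j, Odd i ∧ Even (i + 1 + m) ∧ thueMorse i = a + δ ∧ factorAt thueMorse (i + 1) m = x ∧
      factorAt thueMorse j m = x ∧ thueMorse (j + m) = a := by
  obtain ⟨h₁, h₂, h₃⟩ := h
  obtain ⟨i, hi, hx⟩ := cons_mem_factors_iff.mp h₁
  obtain ⟨j, hj, ha⟩ := append_singleton_mem_factors_iff.mp h₂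
  have hij := hx.trans hj.symm
  refine ⟨i, j, ?_, ?_, hi, hx, hj, ha⟩
  · by_contra heven
    rw [Nat.not_odd_iff_even] at heven
    obtain ⟨j, rfl⟩ : ∃ k, j = k + 1 := by
      refine Nat.exists_eq_succ_of_ne_zero fun hj => ?_
      have := even_iff_even_of_factorAt_eq hm hij
      simp [hj, Nat.even_add_one, heven] at this
    have h := factorAt_succ_eq_of_even hm heven hij
    rw [factorAt_succ, factorAt_succ, List.cons.injEq] at h
    exact h₃ (cons_append_singleton_mem_factors_iff.mpr ⟨j, h.1.symm.trans hi, hj, ha⟩)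
  · by_contra hodd
    rw [Nat.not_even_iff_odd] at hodd
    have h := factorAt_succ_eq_of_odd_add hm hodd hij
    rw [factorAt_succ_right, factorAt_succ_right, List.append_singleton_inj] at h
    exact h₃ (cons_append_singleton_mem_factors_iff.mpr ⟨i, hi, hx, h.2.trans ha⟩)

theorem forbiddenExtensions_two_mul_add_one {m : ℕ} (hm : 2 ≤ m) (δ : ZMod 2) :
    forbiddenExtensions δ (2 * m + 1) = ∅ := by
  rw [Set.eq_empty_iff_forall_notMem]
  rintro ⟨x, a⟩ h
  obtain ⟨i, -, ⟨k, hk⟩, ⟨l, hl⟩, -⟩ := exists_odd_of_mem_forbiddenExtensions (by omega) h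
  omega

theorem forbiddenExtensions_two_mul_subset {m : ℕ} (hm : 2 ≤ m) (δ : ZMod 2) :
    forbiddenExtensions δ (2 * m) ⊆
      (fun p => (thueMorseMap p.1, p.2)) '' forbiddenExtensions (δ + 1) m := by
  rintro ⟨x, a⟩ h
  obtain ⟨_, j, ⟨i, rfl⟩, -, hi, hx, hj, ha⟩ :=
    exists_odd_of_mem_forbiddenExtensions (by omega) h
  have hij := hx.trans hj.symm
  obtain ⟨j, rfl⟩ : ∃ k, j = 2 * k := by
    rw [← even_iff_exists_two_mul, ← even_iff_even_of_factorAt_eq (by omega) hij]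
    simp [Nat.even_add_one]
  rw [thueMorse_two_mul_add_one, CharTwo.add_eq_iff_eq_add, add_assoc] at hi
  rw [show 2 * i + 1 + 1 = 2 * (i + 1) by ring, factorAt_two_mul_even] at hx hij
  rw [factorAt_two_mul_even] at hij
  rw [← mul_add, thueMorse_two_mul] at ha
  refine ⟨(factorAt thueMorse (i + 1) m, a), ⟨?_, ?_, fun h' => h.2.2 ?_⟩, Prod.ext hx rfl⟩
  · exact cons_mem_factors_iff.mpr ⟨i, hi, rfl⟩
  · exact append_singleton_mem_factors_iff.mpr ⟨j, (thueMorseMap_injective hij).symm, ha⟩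
  · obtain ⟨k, hk, hx', ha'⟩ := cons_append_singleton_mem_factors_iff.mp h'
    dsimp only at hk hx' ha' ⊢
    refine ⟨2 * k + 1, ?_⟩
    rw [factorAt_two_mul_add_one_even, hk, hx', hx, ha', ← add_assoc, CharTwo.add_cancel_right]

theorem forbiddenExtensions_two (δ : ZMod 2) : forbiddenExtensions δ 2 = ∅ := by
  rw [Set.eq_empty_iff_forall_notMem]
  rintro ⟨x, a⟩ ⟨h₁, h₂, h₃⟩
  obtain ⟨b, c, rfl⟩ : ∃ b c, x = [b, c] := by
    rw [← List.length_eq_two]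
    simpa using length_of_mem_factors h₁
  rw [mem_factors_thueMorse_iff (by norm_num)] at h₁ h₂ h₃
  exact h₃ (by decide +revert)

theorem forbiddenExtensions_three (δ : ZMod 2) :
    forbiddenExtensions δ 3 = ∅ ∨ δ = 0 ∧ (forbiddenExtensions δ 3).ncard ≤ 4 := by
  have subset_pairs : ∀ p ∈ forbiddenExtensions δ 3, δ = 0 ∧
      p ∈ (({([0, 1, 0], 0), ([0, 1, 0], 1), ([1, 0, 1], 0), ([1, 0, 1], 1)} :
        Finset (List (ZMod 2) × ZMod 2)) : Set (List (ZMod 2) × ZMod 2)) := by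
    rintro ⟨x, a⟩ ⟨h₁, h₂, h₃⟩
    obtain ⟨b, c, d, rfl⟩ : ∃ b c d, x = [b, c, d] := by
      rw [← List.length_eq_three]
      simpa using length_of_mem_factors h₁
    rw [mem_factors_thueMorse_iff (by norm_num)] at h₁ h₂ h₃
    rw [Finset.mem_coe]
    decide +revert
  obtain h | ⟨p, hp⟩ := Set.eq_empty_or_nonempty (forbiddenExtensions δ 3)
  · exact .inl h
  · refine .inr ⟨(subset_pairs p hp).1, ?_⟩
    refine (Set.ncard_le_ncard (fun q hq => (subset_pairs q hq).2) (Finset.finite_toSet _)).trans ?_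
    rw [Set.ncard_coe_finset]
    decide

theorem forbiddenExtensions_eq_empty_or {m : ℕ} (hm : 2 ≤ m) (δ : ZMod 2) :
    forbiddenExtensions δ m = ∅ ∨
      ∃ k : ℕ, m = 3 * 2 ^ k ∧ δ = k ∧ (forbiddenExtensions δ m).ncard ≤ 4 := by
  induction m, hm using two_le_binary_induction generalizing δ with
  | two => exact .inl (forbiddenExtensions_two δ)
  | three =>
    obtain h | ⟨rfl, h⟩ := forbiddenExtensions_three δ
    · exact .inl h
    · exact .inr ⟨0, rfl, Nat.cast_zero.symm, h⟩
  | even m hm ih _ =>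
    have hsubset := forbiddenExtensions_two_mul_subset hm δ
    obtain h | ⟨k, rfl, hδ, hcard⟩ := ih (δ + 1)
    · rw [h, Set.image_empty] at hsubset
      exact .inl (Set.subset_empty_iff.mp hsubset)
    · refine .inr ⟨k + 1, by ring, ?_, ?_⟩
      · rw [Nat.cast_succ, ← hδ, CharTwo.add_cancel_right]
      · have hfinite := finite_forbiddenExtensions (δ + 1) (3 * 2 ^ k)
        exact (Set.ncard_le_ncard hsubset (hfinite.image _)).trans
          ((Set.ncard_image_le hfinite).trans hcard)
  | odd m hm _ _ => exact .inl (forbiddenExtensions_two_mul_add_one hm δ)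

end ForbiddenExtensions

section OddComplexity

/-- The pairs `(x, a)`, with `x` of length `m`, whose cyclic words `μ(x) a` are those of the factors
of length `2 * m + 1`: the two alternatives come from the even and from the odd positions. -/
def oddRepresentatives (m : ℕ) : Set (List (ZMod 2) × ZMod 2) :=
  {p | p.1 ++ [p.2] ∈ factors thueMorse (m + 1) ∨ (p.2 + 1) :: p.1 ∈ factors thueMorse (m + 1)}

/-- The cyclic word `μ(x) a` of a pair `(x, a)`. -/
def oddCycle (p : List (ZMod 2) × ZMod 2) : Cycle (ZMod 2) :=
  (thueMorseMap p.1 ++ [p.2] : List (ZMod 2))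

/-- The pairs `((a + 1) x, a)` and `(x a, a)` have the same cyclic word; the terminal
representatives are those that cannot be replaced in this way by another representative. They
represent every cyclic word exactly once. -/
def terminalRepresentatives (m : ℕ) : Set (List (ZMod 2) × ZMod 2) :=
  {p ∈ oddRepresentatives m | ∀ x, p.1 = (p.2 + 1) :: x →
    (x ++ [p.2], p.2) ∉ oddRepresentatives m}

theorem image_coe_factors_two_mul_add_one (m : ℕ) :
    (fun w : List (ZMod 2) => (w : Cycle (ZMod 2))) '' factors thueMorse (2 * m + 1) =
      oddCycle '' oddRepresentatives m := by
  have heven (i : ℕ) : (factorAt thueMorse (2 * i) (2 * m + 1) : Cycle (ZMod 2)) =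
      oddCycle (factorAt thueMorse i m, thueMorse (i + m)) := by
    rw [oddCycle, factorAt_two_mul_odd]
  have hodd (i : ℕ) : (factorAt thueMorse (2 * i + 1) (2 * m + 1) : Cycle (ZMod 2)) =
      oddCycle (factorAt thueMorse (i + 1) m, thueMorse i + 1) := by
    rw [oddCycle, Cycle.coe_eq_coe, factorAt_two_mul_add_one_odd, ← List.singleton_append]
    exact List.isRotated_append
  apply Set.Subset.antisymm
  · rintro _ ⟨_, ⟨i, rfl⟩, rfl⟩
    obtain ⟨i, rfl | rfl⟩ := Nat.even_or_odd' i
    · exact ⟨_, .inl (append_singleton_mem_factors_iff.mpr ⟨i, rfl, rfl⟩), (heven i).symm⟩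
    · refine ⟨_, .inr (cons_mem_factors_iff.mpr ⟨i, ?_, rfl⟩), (hodd i).symm⟩
      rw [CharTwo.add_cancel_right]
  · rintro _ ⟨⟨x, a⟩, h | h, rfl⟩
    · obtain ⟨i, rfl, rfl⟩ := append_singleton_mem_factors_iff.mp h
      exact ⟨_, ⟨2 * i, rfl⟩, heven i⟩
    · obtain ⟨i, hi, rfl⟩ := cons_mem_factors_iff.mp h
      refine ⟨_, ⟨2 * i + 1, rfl⟩, (hodd i).trans ?_⟩
      rw [hi, CharTwo.add_cancel_right]

theorem oddCycle_append_singleton (x : List (ZMod 2)) (a : ZMod 2) :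
    oddCycle (x ++ [a], a) = oddCycle ((a + 1) :: x, a) := by
  rw [oddCycle, oddCycle, Cycle.coe_eq_coe, isRotated_iff_exists_append]
  refine ⟨thueMorseMap x ++ [a], [a + 1, a], ?_, ?_⟩
  · simp [thueMorseMap_concat]
  · simp [thueMorseMap, CharTwo.add_cancel_right]

theorem mem_terminalRepresentatives_or_exists {m : ℕ} {y : List (ZMod 2)} {a : ZMod 2}
    (h : (y, a) ∈ oddRepresentatives m) : (y, a) ∈ terminalRepresentatives m ∨
      ∃ x, y = (a + 1) :: x ∧ (x ++ [a], a) ∈ oddRepresentatives m := by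
  rw [or_iff_not_imp_right]
  exact fun hx => ⟨h, fun x hy hmem => hx ⟨x, hy, hmem⟩⟩

theorem image_oddCycle_terminalRepresentatives (m : ℕ) :
    oddCycle '' terminalRepresentatives m = oddCycle '' oddRepresentatives m := by
  refine (Set.image_mono fun p hp => hp.1).antisymm ?_
  rintro _ ⟨⟨y, a⟩, hy, rfl⟩
  induction hn : y.count (a + 1) generalizing y with
  | zero =>
    refine ⟨_, ⟨hy, ?_⟩, rfl⟩
    rintro x (rfl : y = (a + 1) :: x)
    simp at hn
  | succ n ih =>
    obtain ht | ⟨x, rfl, hx⟩ := mem_terminalRepresentatives_or_exists hy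
    · exact ⟨_, ht, rfl⟩
    · rw [← oddCycle_append_singleton]
      refine ih _ hx ?_
      simpa [List.count_append, List.count_singleton] using hn

theorem exists_replicate_of_append_singleton_of_even {y y' u v : List (ZMod 2)} {a a' : ZMod 2}
    (h : thueMorseMap y ++ [a] = u ++ v) (h' : thueMorseMap y' ++ [a'] = v ++ u)
    (hu : Even u.length) :
    ∃ k w, a' = a ∧ y = List.replicate k (a + 1) ++ w ∧ y' = w ++ List.replicate k a := by
  have hlength := congrArg List.length h
  simp only [List.length_append, length_thueMorseMap, List.length_singleton] at hlength
  obtain ⟨y₁, y₂, rfl, rfl, rfl⟩ := exists_of_thueMorseMap_append_eq_append_of_even h hu (by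
    obtain ⟨k, hk⟩ := hu
    omega)
  have hlength' := congrArg List.length h'
  rw [List.append_assoc] at h'
  simp only [List.length_append, length_thueMorseMap, List.length_singleton] at hlength'
  obtain ⟨z₁, z₂, rfl, hz₁, hz₂⟩ := exists_of_thueMorseMap_append_eq_append_of_even h'
    (by simp [length_thueMorseMap]) (by rw [length_thueMorseMap]; omega)
  obtain ⟨k, rfl, rfl, rfl⟩ := eq_replicate_of_cons_thueMorseMap_eq_append hz₂
  exact ⟨k, y₂, rfl, rfl, by rw [thueMorseMap_injective hz₁]⟩

theorem eq_zero_of_mem_terminalRepresentatives {m k : ℕ} {w : List (ZMod 2)} {a : ZMod 2}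
    (h : (List.replicate k (a + 1) ++ w, a) ∈ terminalRepresentatives m)
    (h' : (w ++ List.replicate k a, a) ∈ oddRepresentatives m) : k = 0 := by
  obtain ⟨hp, hterminal⟩ := h
  obtain _ | _ | k := k
  · rfl
  · exact absurd h' (hterminal w rfl)
  · refine absurd ?_ (hterminal (List.replicate (k + 1) (a + 1) ++ w) rfl)
    obtain hp | hp := hp
    · exact .inr (by simpa only [List.replicate_succ, List.cons_append, List.append_assoc] using hp)
    · have := le_two_of_replicate_isInfix (k := k + 3) hp ⟨[], w, rfl⟩
      omega

theorem injOn_oddCycle (m : ℕ) : Set.InjOn oddCycle (terminalRepresentatives m) := by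
  have eq_of_even {p q : List (ZMod 2) × ZMod 2} {u v : List (ZMod 2)}
      (hp : p ∈ terminalRepresentatives m) (hq : q ∈ terminalRepresentatives m)
      (h : thueMorseMap p.1 ++ [p.2] = u ++ v) (h' : thueMorseMap q.1 ++ [q.2] = v ++ u)
      (hu : Even u.length) : p = q := by
    obtain ⟨y, a⟩ := p
    obtain ⟨y', a'⟩ := q
    dsimp only at h h'
    obtain ⟨k, w, rfl, rfl, rfl⟩ := exists_replicate_of_append_singleton_of_even h h' hu
    obtain rfl := eq_zero_of_mem_terminalRepresentatives hp hq.1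
    simp
  intro p hp q hq h
  obtain ⟨u, v, h₁, h₂⟩ := isRotated_iff_exists_append.mp (Cycle.coe_eq_coe.mp h)
  obtain hu | hu := Nat.even_or_odd u.length
  · exact eq_of_even hp hq h₁ h₂ hu
  · have hlength := congrArg List.length h₁
    simp only [List.length_append, length_thueMorseMap, List.length_singleton] at hlength
    have hv : Even v.length := by
      have : Odd (u.length + v.length) := ⟨_, hlength.symm⟩
      exact (Nat.odd_add.mp this).mp hu
    exact (eq_of_even hq hp h₂ h₁ hv).symm

theorem finite_and_ncard_preimage_append_singleton (m : ℕ) :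
    {p : List (ZMod 2) × ZMod 2 | p.1 ++ [p.2] ∈ factors thueMorse (m + 1)}.Finite ∧
    {p : List (ZMod 2) × ZMod 2 | p.1 ++ [p.2] ∈ factors thueMorse (m + 1)}.ncard =
      (factors thueMorse (m + 1)).ncard := by
  have hinj : Function.Injective fun p : List (ZMod 2) × ZMod 2 => p.1 ++ [p.2] :=
    fun p q h => Prod.ext_iff.mpr (List.append_singleton_inj.mp h)
  refine ⟨(finite_factors thueMorse (m + 1)).preimage hinj.injOn,
    Set.ncard_preimage_of_injective_subset_range hinj ?_⟩
  rintro _ ⟨i, rfl⟩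
  exact ⟨(_, _), (factorAt_succ_right thueMorse i m).symm⟩

theorem finite_and_ncard_preimage_cons (m : ℕ) :
    {p : List (ZMod 2) × ZMod 2 | (p.2 + 1) :: p.1 ∈ factors thueMorse (m + 1)}.Finite ∧
    {p : List (ZMod 2) × ZMod 2 | (p.2 + 1) :: p.1 ∈ factors thueMorse (m + 1)}.ncard =
      (factors thueMorse (m + 1)).ncard := by
  have hinj : Function.Injective fun p : List (ZMod 2) × ZMod 2 => (p.2 + 1) :: p.1 := by
    intro p q h
    rw [List.cons.injEq, add_left_inj] at h
    exact Prod.ext h.2 h.1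
  refine ⟨(finite_factors thueMorse (m + 1)).preimage hinj.injOn,
    Set.ncard_preimage_of_injective_subset_range hinj ?_⟩
  rintro _ ⟨i, rfl⟩
  refine ⟨(factorAt thueMorse (i + 1) m, thueMorse i + 1), ?_⟩
  dsimp only
  rw [factorAt_succ, CharTwo.add_cancel_right]

theorem finite_oddRepresentatives (m : ℕ) : (oddRepresentatives m).Finite :=
  (finite_and_ncard_preimage_append_singleton m).1.union (finite_and_ncard_preimage_cons m).1

theorem distinctEnds_union_forbiddenExtensions (m : ℕ) :
    distinctEnds m ∪ forbiddenExtensions 1 m =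
      {p | p.1 ++ [p.2] ∈ factors thueMorse (m + 1)} ∩
        {p | (p.2 + 1) :: p.1 ∈ factors thueMorse (m + 1)} := by
  apply Set.Subset.antisymm
  · rintro ⟨x, a⟩ (h | h)
    · obtain ⟨i, hi, hx, ha⟩ := cons_append_singleton_mem_factors_iff.mp h
      exact ⟨append_singleton_mem_factors_iff.mpr ⟨i + 1, hx, ha⟩,
        cons_mem_factors_iff.mpr ⟨i, hi, hx⟩⟩
    · exact ⟨h.2.1, h.1⟩
  · intro p h
    rw [Set.mem_union, or_iff_not_imp_left]
    exact fun hp => ⟨h.2, h.1, hp⟩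

theorem ncard_oddRepresentatives (m : ℕ) :
    (oddRepresentatives m).ncard + (endsCount (m + 1) 1 + (forbiddenExtensions 1 m).ncard) =
      2 * (factors thueMorse (m + 1)).ncard := by
  obtain ⟨hfinite, hncard⟩ := finite_and_ncard_preimage_append_singleton m
  obtain ⟨hfinite', hncard'⟩ := finite_and_ncard_preimage_cons m
  have hunion := distinctEnds_union_forbiddenExtensions m
  have hdisjoint : Disjoint (distinctEnds m) (forbiddenExtensions 1 m) := by
    rw [Set.disjoint_left]
    exact fun p hp hp' => hp'.2.2 hp
  have hdistinct : (distinctEnds m).Finite :=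
    (hfinite.inter_of_left _).subset (hunion ▸ Set.subset_union_left)
  rw [← ncard_distinctEnds, ← Set.ncard_union_eq hdisjoint hdistinct
    (finite_forbiddenExtensions 1 m), hunion, oddRepresentatives, Set.ofPred_or,
    Set.ncard_union_add_ncard_inter _ _ hfinite hfinite', hncard, hncard', two_mul]

-- If `4 ≤ n`, then `x` determines the parity of its position. The square `a a` is not a block
-- `μ(b)`, so `a` and the last letter of `x` form one, and `a` follows every occurrence of `x`.
theorem cons_append_mem_factors_of_squares {n : ℕ} {x : List (ZMod 2)} {a : ZMod 2}
    (h : (a + 1) :: (a + 1) :: x ∈ factors thueMorse (n + 2))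
    (h' : x ++ [a] ++ [a] ∈ factors thueMorse (n + 2)) :
    (a + 1) :: (x ++ [a]) ∈ factors thueMorse (n + 2) := by
  obtain hn | hn := lt_or_ge n 4
  · have hx : x.length = n := by simpa using length_of_mem_factors h
    rw [mem_factors_thueMorse_iff (by omega)] at h h' ⊢
    obtain _ | ⟨b, _ | ⟨c, _ | ⟨d, _ | ⟨e, x⟩⟩⟩⟩ := x
    case cons.cons.cons.cons =>
      simp only [List.length_cons] at hx
      omega
    all_goals
      simp only [List.length_cons, List.length_nil] at hx
      subst hx
      clear hn
      decide +revert
  · obtain ⟨i, -, h⟩ := cons_mem_factors_iff.mp h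
    rw [factorAt_succ, List.cons.injEq] at h
    obtain ⟨j, h', hj⟩ := append_singleton_mem_factors_iff.mp h'
    rw [factorAt_succ_right, List.append_singleton_inj] at h'
    have hij := h.2.trans h'.1.symm
    have hj_odd : Odd (j + n) := by
      rw [← Nat.not_even_iff_odd]
      exact fun hj_even => thueMorse_ne_succ_of_even hj_even (h'.2.trans hj.symm)
    have hij_odd := even_iff_even_of_factorAt_eq hn hij
    have hn_odd : Odd (i + 1 + 1 + n) := by
      rw [← Nat.not_even_iff_odd, Nat.even_add, hij_odd, ← Nat.even_add, Nat.not_even_iff_odd]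
      exact hj_odd
    have heq := factorAt_succ_eq_of_odd_add hn hn_odd hij
    rw [factorAt_succ_right, factorAt_succ_right, List.append_singleton_inj] at heq
    exact cons_append_singleton_mem_factors_iff.mpr ⟨i + 1, h.1, h.2, heq.2.trans h'.2⟩

theorem mem_oddRepresentatives_and_iff {m : ℕ} {x : List (ZMod 2)} {a : ZMod 2} :
    ((a + 1) :: x, a) ∈ oddRepresentatives (m + 1) ∧ (x ++ [a], a) ∈ oddRepresentatives (m + 1) ↔
      (x, a) ∈ distinctEnds m := by
  constructor
  · rintro ⟨h | h, h' | h'⟩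
    · exact h
    · exact h
    · exact cons_append_mem_factors_of_squares h h'
    · exact h'
  · exact fun h => ⟨.inl h, .inr h⟩

theorem oddRepresentatives_eq_union (m : ℕ) :
    oddRepresentatives (m + 1) =
      terminalRepresentatives (m + 1) ∪ (fun p => ((p.2 + 1) :: p.1, p.2)) '' distinctEnds m := by
  ext ⟨y, a⟩
  constructor
  · intro hy
    obtain ht | ⟨x, rfl, hx⟩ := mem_terminalRepresentatives_or_exists hy
    · exact .inl ht
    · exact .inr ⟨(x, a), mem_oddRepresentatives_and_iff.mp ⟨hy, hx⟩, rfl⟩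
  · rintro (h | ⟨⟨x, b⟩, hx, h⟩)
    · exact h.1
    · exact h ▸ (mem_oddRepresentatives_and_iff.mpr hx).1

theorem ncard_oddRepresentatives_eq_add {m : ℕ} (hm : 1 ≤ m) :
    (oddRepresentatives m).ncard = (terminalRepresentatives m).ncard + endsCount m 1 := by
  obtain ⟨m, rfl⟩ := Nat.exists_eq_add_of_le' hm
  have hinj : Function.Injective fun p : List (ZMod 2) × ZMod 2 => ((p.2 + 1) :: p.1, p.2) :=
    fun p q h => Prod.ext (List.tail_eq_of_cons_eq (Prod.ext_iff.mp h).1) (Prod.ext_iff.mp h).2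
  have hdisjoint : Disjoint (terminalRepresentatives (m + 1))
      ((fun p => ((p.2 + 1) :: p.1, p.2)) '' distinctEnds m) := by
    rw [Set.disjoint_left]
    rintro _ hp ⟨⟨x, a⟩, hx, rfl⟩
    exact hp.2 x rfl (mem_oddRepresentatives_and_iff.mpr hx).2
  have hfinite := finite_oddRepresentatives (m + 1)
  rw [oddRepresentatives_eq_union, Set.finite_union] at hfinite
  rw [oddRepresentatives_eq_union, Set.ncard_union_eq hdisjoint hfinite.1 hfinite.2,
    Set.ncard_image_of_injective _ hinj, ncard_distinctEnds]

theorem cyclicComplexity_two_mul_add_one {m : ℕ} (hm : 1 ≤ m) :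
    cyclicComplexity thueMorse (2 * m + 1) + (forbiddenExtensions 1 m).ncard +
        (factors thueMorse (m + 2)).ncard =
      endsCount (2 * m + 1) 1 + (factors thueMorse (m + 1)).ncard := by
  have hcard := ncard_oddRepresentatives m
  have hcard' := ncard_oddRepresentatives_eq_add hm
  rw [cyclicComplexity, image_coe_factors_two_mul_add_one,
    ← image_oddCycle_terminalRepresentatives, (injOn_oddCycle m).ncard_image,
    endsCount_two_mul_add_one hm, CharTwo.add_self_eq_zero]
  rw [ncard_factors_succ] at hcard ⊢
  rw [ncard_factors_succ]
  omega

end OddComplexity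

section Conclusion

theorem cyclicComplexity_pos (n : ℕ) : 0 < cyclicComplexity thueMorse n :=
  (Set.ncard_pos (finite_cyclic_factors thueMorse n)).mpr ⟨_, _, factorAt_mem_factors _ 0 n, rfl⟩

theorem card_image_range_le_cyclicComplexity (n N : ℕ) :
    ((Finset.range N).image fun i => (factorAt thueMorse i n : Cycle (ZMod 2))).card ≤
      cyclicComplexity thueMorse n := by
  rw [← Set.ncard_coe_finset]
  refine Set.ncard_le_ncard ?_ (finite_cyclic_factors thueMorse n)
  intro c hc
  obtain ⟨i, -, rfl⟩ := Finset.mem_image.mp hc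
  exact ⟨_, factorAt_mem_factors _ i n, rfl⟩

/-- Three times the amount by which the number of cyclic words of factors of length `n` of the
Thue-Morse word exceeds `4 / 3 * n - 4`. -/
noncomputable def cyclicExcess (n : ℕ) : ℤ :=
  3 * cyclicComplexity thueMorse n + 12 - 4 * n

set_option maxRecDepth 4000 in
theorem cyclicExcess_pos_of_lt {n : ℕ} (hn : n < 8) : 0 < cyclicExcess n := by
  have h₃ := cyclicComplexity_pos 3
  have h₄ : 2 ≤ cyclicComplexity thueMorse 4 :=
    le_trans (by decide) (card_image_range_le_cyclicComplexity 4 4)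
  have h₅ : 3 ≤ cyclicComplexity thueMorse 5 :=
    le_trans (by decide) (card_image_range_le_cyclicComplexity 5 12)
  have h₆ : 5 ≤ cyclicComplexity thueMorse 6 :=
    le_trans (by decide) (card_image_range_le_cyclicComplexity 6 16)
  have h₇ : 6 ≤ cyclicComplexity thueMorse 7 :=
    le_trans (by decide) (card_image_range_le_cyclicComplexity 7 16)
  rw [cyclicExcess]
  interval_cases n <;> omega

theorem cyclicExcess_two_mul {m : ℕ} (hm : 4 ≤ m) :
    cyclicExcess (2 * m) = cyclicExcess m + endsExcess m 1 := by
  rw [cyclicExcess, cyclicExcess, endsExcess, cyclicComplexity_two_mul hm]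
  push_cast
  ring

theorem cyclicExcess_two_mul_add_one {m : ℕ} (hm : 1 ≤ m) :
    cyclicExcess (2 * m + 1) = endsExcess (2 * m + 1) 1 + 12 - 3 * complexityDifference (m + 1) -
      3 * (forbiddenExtensions 1 m).ncard := by
  have h := cyclicComplexity_two_mul_add_one hm
  rw [cyclicExcess, endsExcess, complexityDifference, add_assoc m, one_add_one_eq_two]
  omega

theorem cyclicExcess_two_mul_add_one_nonneg_and_eq_zero_iff {m : ℕ} (hm : 4 ≤ m) :
    0 ≤ cyclicExcess (2 * m + 1) ∧
      (cyclicExcess (2 * m + 1) = 0 ↔ ∃ j, 1 ≤ j ∧ m = 2 ^ (2 * j)) := by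
  have hends := endsExcess_one_nonneg (m := 2 * m + 1) (by omega)
  have hdifference := complexityDifference_eq_two_or_four (n := m + 1) (by omega)
  rw [← endsExcess_eq_zero_and_complexityDifference_eq_four_iff hm,
    cyclicExcess_two_mul_add_one (by omega)]
  obtain h | ⟨k, rfl, hk, hcard⟩ := forbiddenExtensions_eq_empty_or (by omega : 2 ≤ m) 1
  · rw [h, Set.ncard_empty]
    omega
  · have hk : 1 ≤ k := Nat.one_le_iff_ne_zero.mpr (by rintro rfl; simp at hk)
    have hexcess := le_endsExcess_six_mul_two_pow_add_one hk
    have hdifference := complexityDifference_three_mul_two_pow_add_one k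
    have hpow : (2 : ℤ) ^ 1 ≤ 2 ^ k := pow_le_pow_right₀ one_le_two hk
    omega

theorem two_mul_mem_setJ_iff {m : ℕ} : 2 * m ∈ setJ ↔ m ∈ setJ := by
  constructor
  · rintro ⟨i, _ | j, hi, h⟩
    · rw [pow_succ'] at h
      omega
    · rw [pow_succ' 2 j, mul_left_comm] at h
      exact ⟨i, j, hi, Nat.eq_of_mul_eq_mul_left two_pos h⟩
  · rintro ⟨i, j, hi, rfl⟩
    exact ⟨i, j + 1, hi, by ring⟩

theorem two_mul_add_one_mem_setJ_iff {m : ℕ} :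
    2 * m + 1 ∈ setJ ↔ ∃ j, 1 ≤ j ∧ m = 2 ^ (2 * j) := by
  constructor
  · rintro ⟨i, _ | j, hi, h⟩
    · rw [pow_succ'] at h
      exact ⟨i, hi, by omega⟩
    · rw [pow_succ' 2 j, mul_left_comm] at h
      omega
  · rintro ⟨j, hj, rfl⟩
    exact ⟨j, 0, hj, by ring⟩

theorem nine_le_of_mem_setJ {n : ℕ} (h : n ∈ setJ) : 9 ≤ n := by
  obtain ⟨i, j, hi, rfl⟩ := h
  have hpow : 2 ^ 3 ≤ 2 ^ (2 * i + 1) := Nat.pow_le_pow_right two_pos (by omega)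
  calc 9 ≤ (2 ^ (2 * i + 1) + 1) * 1 := by omega
    _ ≤ (2 ^ (2 * i + 1) + 1) * 2 ^ j := Nat.mul_le_mul_left _ Nat.one_le_two_pow

theorem endsExcess_eq_zero_of_mem_setJ {n : ℕ} (h : n ∈ setJ) : endsExcess n 1 = 0 := by
  obtain ⟨i, j, hi, rfl⟩ := h
  induction j with
  | zero => rw [pow_zero, mul_one, endsExcess_two_pow_odd_add_one]
  | succ j ih =>
    have hnine := nine_le_of_mem_setJ ⟨i, j, hi, rfl⟩
    rw [pow_succ' 2 j, mul_left_comm, endsExcess_two_mul (by omega), ih, mul_zero]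

theorem cyclicExcess_nonneg_and_eq_zero_iff (n : ℕ) :
    0 ≤ cyclicExcess n ∧ (cyclicExcess n = 0 ↔ n ∈ setJ) := by
  induction n using Nat.strong_induction_on with
  | _ n ih =>
  obtain hn | hn := lt_or_ge n 8
  · have hpos := cyclicExcess_pos_of_lt hn
    exact ⟨hpos.le, iff_of_false hpos.ne' fun h => hn.not_ge (by linarith [nine_le_of_mem_setJ h])⟩
  obtain ⟨m, rfl | rfl⟩ := Nat.even_or_odd' n
  · obtain ⟨hnonneg, hzero⟩ := ih m (by omega)
    have hends := endsExcess_one_nonneg (m := m) (by omega)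
    rw [cyclicExcess_two_mul (by omega), two_mul_mem_setJ_iff,
      add_eq_zero_iff_of_nonneg hnonneg hends, hzero]
    exact ⟨add_nonneg hnonneg hends, and_iff_left_of_imp endsExcess_eq_zero_of_mem_setJ⟩
  · rw [two_mul_add_one_mem_setJ_iff]
    exact cyclicExcess_two_mul_add_one_nonneg_and_eq_zero_iff (by omega)

end Conclusion

theorem theorem8 (n : ℕ) :
    (cyclicComplexity thueMorse n : ℝ) = 4 / 3 * (n : ℝ) - 4 ↔ n ∈ setJ := by
  rw [← (cyclicExcess_nonneg_and_eq_zero_iff n).2, cyclicExcess, ← Int.cast_inj (α := ℝ)]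
  push_cast
  constructor <;> intro h <;> linarith
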